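/- Let $k$ be a field and let $1 \le a < b < d$ be integers with $b \ge a+2$. Let $R = k[x^{\alpha}y^{d-\alpha} \mid \alpha \in [0,a]\cup[b,d]] \subseteq k[x,y]$, where $[p,q]$ denotes the set of integers $\alpha$ with $p \le \alpha \le q$. Grade $R$ so that the given monomial generators have degree $1$, let $R_+$ be the maximal graded ideal of $R$, and let $Q = (x^d,y^d)$ be the ideal of $R$ generated by $x^d$ and $y^d$. Let $r_Q(R_+)$ be the reduction number of $R_+$ with respect to $Q$, that is, the least integer $r \ge 0$ with $Q\,(R_+)^r = (R_+)^{r+1}$. Then the following conditions are equivalent: (1) $R$ is a Buchsbaum ring, that is, the local ring $A = R_{R_+}$, with maximal ideal $\mathfrak m$, is a Buchsbaum local ring: $A$ is Noetherian and every system of parameters $x_1,\dots,x_n$ of $A$ (where $n = \dim A$) satisfies $\mathfrak m\cdot\big((x_1,\dots,x_{i-1}):x_i\big) \subseteq (x_1,\dots,x_{i-1})$ for $i = 1,\dots,n$; (2) $2a+1 \ge b$ and $a+d+1 \ge 2b$; (3) $r_Q(R_+) = 2$. -/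

import Mathlib

open MvPolynomial

section ReductionNumber

variable {R : Type*} [CommRing R]

/-- `J ⊆ I` is a reduction of `I` if `J * I ^ r = I ^ (r + 1)` for some `r ≥ 0`. -/
def IsReduction (J I : Ideal R) : Prop :=
  J ≤ I ∧ ∃ r : ℕ, J * I ^ r = I ^ (r + 1)

/-- The reduction number `r_J(I)`: the least `r ≥ 0` with `J * I ^ r = I ^ (r + 1)`. It is
meaningful when `J` is a reduction of `I`; if there is no such `r` the value is `0`. -/
noncomputable def reductionNumber (J I : Ideal R) : ℕ :=
  sInf {r : ℕ | J * I ^ r = I ^ (r + 1)}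

end ReductionNumber

section Buchsbaum

variable (A : Type*) [CommRing A] [IsLocalRing A]

variable {A} in
/-- A system of parameters of a Noetherian local ring `A`: a sequence of `dim A` elements
generating an ideal whose radical is the maximal ideal. -/
def IsSystemOfParameters {n : ℕ} (x : Fin n → A) : Prop :=
  ringKrullDim A = n ∧
    (Ideal.span (Set.range x)).radical = IsLocalRing.maximalIdeal A

variable {A} in
/-- `x₁, …, xₙ` is a weak sequence if, with `𝔪` the maximal ideal,
`𝔪 * ((x₁, …, xᵢ₋₁) : xᵢ) ⊆ (x₁, …, xᵢ₋₁)` for all `i = 1, …, n`. -/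
def IsWeakSequence {n : ℕ} (x : Fin n → A) : Prop :=
  ∀ i : Fin n, ∀ y : A, x i * y ∈ Ideal.span (x '' Set.Iio i) →
    ∀ m ∈ IsLocalRing.maximalIdeal A, m * y ∈ Ideal.span (x '' Set.Iio i)

/-- A Buchsbaum local ring: a Noetherian local ring in which every system of parameters is a
weak sequence. -/
def IsBuchsbaumLocalRing : Prop :=
  IsNoetherianRing A ∧
    ∀ (n : ℕ) (x : Fin n → A), IsSystemOfParameters x → IsWeakSequence x

end Buchsbaum

section MonomialCurve

variable (k : Type*) [Field k]

/-- The set of monomials `x ^ α * y ^ (d - α)`, `α ∈ [0, a] ∪ [b, d]`, of `k[x, y]`. -/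
def twoIntervalMonomials (a b d : ℕ) : Set (MvPolynomial (Fin 2) k) :=
  {f | ∃ α ∈ Set.Icc 0 a ∪ Set.Icc b d, f = X 0 ^ α * X 1 ^ (d - α)}

/-- The algebra `R = k[x ^ α * y ^ (d - α) : α ∈ [0, a] ∪ [b, d]]`, as a subalgebra
of `k[x, y]`. -/
noncomputable abbrev twoIntervalAlgebra (a b d : ℕ) :
    Subalgebra k (MvPolynomial (Fin 2) k) :=
  Algebra.adjoin k (twoIntervalMonomials k a b d)

variable {k}

/-- The ideal of the polynomials in `R` without constant term. If `R ⊆ k[x, y]` is generated by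
monomials of one degree `d > 0`, graded so that the generators have degree `1`, then `R₀ = k` and
`Rₙ` consists of forms of degree `n * d`, so this is the maximal graded ideal
`R₊ = ⨁_{n ≥ 1} Rₙ`. -/
noncomputable def irrelevantIdeal (R : Subalgebra k (MvPolynomial (Fin 2) k)) : Ideal R :=
  RingHom.ker ((constantCoeff : MvPolynomial (Fin 2) k →+* k).comp R.val.toRingHom)

instance irrelevantIdeal_isPrime (R : Subalgebra k (MvPolynomial (Fin 2) k)) :
    (irrelevantIdeal R).IsPrime :=
  RingHom.ker_isPrime _

/-- `R` is a Buchsbaum ring if its local ring at `R₊` is a Buchsbaum local ring. -/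
def IsBuchsbaumAlgebra (R : Subalgebra k (MvPolynomial (Fin 2) k)) : Prop :=
  IsBuchsbaumLocalRing (Localization.AtPrime (irrelevantIdeal R))

/-- The ideal `Q = (x ^ d, y ^ d)` of `R`, for an `R` that contains `x ^ d` and `y ^ d`. -/
noncomputable def parameterIdeal (R : Subalgebra k (MvPolynomial (Fin 2) k)) (d : ℕ) : Ideal R :=
  Ideal.span {f : R | (f : MvPolynomial (Fin 2) k) = X 0 ^ d ∨
    (f : MvPolynomial (Fin 2) k) = X 1 ^ d}

end MonomialCurve

/-! ### Exponents of the monomials of R. -/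

section Monomials

variable {k : Type*} [Field k] {a b d : ℕ}

/-! Let S be the d-th Veronese subring of k[x, y]. In degree n, the x-exponents of monomials of R
lie in the intervals [jb, jd + ia] with i + j = n. For n = 2 these are [0, 2a], [b, a + d] and [2b,
2d]; they cover [0, 2d] exactly when b ≤ 2a + 1 and 2b ≤ a + d + 1. So (2) says that R and S agree
in degree 2, and then in all degrees ≥ 2 (`X_pow_mul_X_pow_mem`).

Buchsbaum property: when y₀ lies in (x₀) : x₁ for a system of parameters x₀, x₁, the fraction y₀/x₀
lies, up to a unit, in S. Under (2), R₊S ⊆ R, so 𝔪 carries y₀ into (x₀). Conversely, every monomial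
of degree d is such a fraction for the parameters x^(d²), y^(d²), so the Buchsbaum property forces
R₊S₁ ⊆ R (`IsBuchsbaumLocalRing.exists_of_le`), which fails at exponent 2a + 1 or a + d + 1 unless
(2) holds.

Reduction number: a monomial of degree 3 is divisible by x^d or y^d, and under (2) the quotient lies
in R₊², so QR₊² = R₊³. Exponents just outside the intervals show that (2) is needed and that no r <
2 works. -/

lemma X_pow_mul_X_pow_eq_monomial (p q : ℕ) :
    (X 0 ^ p * X 1 ^ q : MvPolynomial (Fin 2) k) =
      monomial (Finsupp.single 0 p + Finsupp.single 1 q) 1 := by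
  rw [X_pow_eq_monomial, X_pow_eq_monomial, monomial_mul, one_mul]

lemma monomial_eq_X_pow_mul_X_pow (e : Fin 2 →₀ ℕ) :
    (monomial e 1 : MvPolynomial (Fin 2) k) = X 0 ^ e 0 * X 1 ^ e 1 := by
  rw [X_pow_mul_X_pow_eq_monomial]
  congr 2
  ext i
  fin_cases i <;> simp

lemma mem_support_X_pow_mul_X_pow (p q : ℕ) :
    (Finsupp.single 0 p + Finsupp.single 1 q : Fin 2 →₀ ℕ) ∈
      (X 0 ^ p * X 1 ^ q : MvPolynomial (Fin 2) k).support := by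
  classical
  rw [X_pow_mul_X_pow_eq_monomial, mem_support_iff, coeff_monomial, if_pos rfl]
  exact one_ne_zero

lemma exists_add_of_mem_support_mul {σ A : Type*} [CommSemiring A] {f g : MvPolynomial σ A}
    {e : σ →₀ ℕ} (he : e ∈ (f * g).support) :
    ∃ u ∈ f.support, ∃ v ∈ g.support, u + v = e := by
  classical
  exact Finset.mem_add.1 (support_mul f g he)

/-- The exponents of the elements of an algebra generated by monomials lie in every additive
monoid that contains the exponents of the generators. -/
lemma support_subset_of_mem_twoIntervalAlgebra (T : AddSubmonoid (Fin 2 →₀ ℕ))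
    (hT : ∀ α ∈ Set.Icc 0 a ∪ Set.Icc b d,
      (Finsupp.single 0 α + Finsupp.single 1 (d - α) : Fin 2 →₀ ℕ) ∈ T)
    {f : MvPolynomial (Fin 2) k} (hf : f ∈ twoIntervalAlgebra k a b d) :
    ∀ e ∈ f.support, e ∈ T := by
  classical
  induction hf using Algebra.adjoin_induction with
  | mem f hf =>
    obtain ⟨α, hα, rfl⟩ := hf
    intro e he
    rw [X_pow_mul_X_pow_eq_monomial] at he
    rw [Finset.mem_singleton.1 (support_monomial_subset he)]
    exact hT α hα
  | algebraMap r =>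
    intro e he
    rw [algebraMap_eq, C_apply] at he
    rw [Finset.mem_singleton.1 (support_monomial_subset he)]
    exact T.zero_mem
  | add f g _ _ hf hg =>
    intro e he
    rcases Finset.mem_union.1 (support_add he) with h | h
    exacts [hf e h, hg e h]
  | mul f g _ _ hf hg =>
    intro e he
    obtain ⟨u, hu, v, hv, rfl⟩ := exists_add_of_mem_support_mul he
    exact T.add_mem (hf u hu) (hg v hv)

lemma generator_mem {α : ℕ} (hα : α ≤ a ∨ b ≤ α ∧ α ≤ d) :
    (X 0 ^ α * X 1 ^ (d - α) : MvPolynomial (Fin 2) k) ∈ twoIntervalAlgebra k a b d :=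
  Algebra.subset_adjoin ⟨α, by simpa using hα, rfl⟩

/-- An element of the algebra has only exponents of monomials that lie in the algebra. -/
lemma monomial_mem_of_mem_support {f : MvPolynomial (Fin 2) k}
    (hf : f ∈ twoIntervalAlgebra k a b d) {e : Fin 2 →₀ ℕ} (he : e ∈ f.support) :
    (X 0 ^ e 0 * X 1 ^ e 1 : MvPolynomial (Fin 2) k) ∈ twoIntervalAlgebra k a b d := by
  let T : AddSubmonoid (Fin 2 →₀ ℕ) :=
    { carrier := {e | (monomial e 1 : MvPolynomial (Fin 2) k) ∈ twoIntervalAlgebra k a b d}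
      zero_mem' := one_mem (twoIntervalAlgebra k a b d)
      add_mem' := fun {u v} hu hv => by
        have := (twoIntervalAlgebra k a b d).mul_mem hu hv
        rwa [monomial_mul, one_mul] at this }
  rw [← monomial_eq_X_pow_mul_X_pow]
  refine support_subset_of_mem_twoIntervalAlgebra T (fun α hα => ?_) hf e he
  change monomial (Finsupp.single 0 α + Finsupp.single 1 (d - α)) 1 ∈ twoIntervalAlgebra k a b d
  rw [← X_pow_mul_X_pow_eq_monomial]
  exact generator_mem (by simpa using hα)

lemma mem_of_forall_monomial_mem {f : MvPolynomial (Fin 2) k}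
    (hf : ∀ e ∈ f.support,
      (X 0 ^ e 0 * X 1 ^ e 1 : MvPolynomial (Fin 2) k) ∈ twoIntervalAlgebra k a b d) :
    f ∈ twoIntervalAlgebra k a b d := by
  rw [f.as_sum]
  refine sum_mem fun e he => ?_
  have := Subalgebra.smul_mem _ (hf e he) (coeff e f)
  rwa [← monomial_eq_X_pow_mul_X_pow, smul_monomial, smul_eq_mul, mul_one] at this

/-- The exponents of degree `n = i + j` in the algebra: sums of `i` exponents from the lower
interval and `j` exponents from the upper one. -/
lemma exists_of_mem_support {f : MvPolynomial (Fin 2) k}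
    (hf : f ∈ twoIntervalAlgebra k a b d) {e : Fin 2 →₀ ℕ} (he : e ∈ f.support)
    (had : a ≤ d) : ∃ i j, e 0 + e 1 = (i + j) * d ∧ j * b ≤ e 0 ∧ e 0 ≤ j * d + i * a := by
  let T : AddSubmonoid (Fin 2 →₀ ℕ) :=
    { carrier := {e | ∃ i j, e 0 + e 1 = (i + j) * d ∧ j * b ≤ e 0 ∧ e 0 ≤ j * d + i * a}
      zero_mem' := ⟨0, 0, by simp⟩
      add_mem' := fun {u v} hu hv => by
        obtain ⟨i, j, h1, h2, h3⟩ := hu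
        obtain ⟨i', j', h1', h2', h3'⟩ := hv
        refine ⟨i + i', j + j', ?_, ?_, ?_⟩ <;> simp only [Finsupp.add_apply]
        · linarith
        · linarith
        · linarith }
  refine support_subset_of_mem_twoIntervalAlgebra T (fun α hα => ?_) hf e he
  change ∃ i j, _
  simp only [Set.mem_union, Set.mem_Icc, Finsupp.add_apply, Finsupp.single_apply] at hα ⊢
  rcases hα with h | h
  · exact ⟨1, 0, by simp; omega⟩
  · exact ⟨0, 1, by simp; omega⟩

lemma X_zero_pow_mem (hbd : b < d) :
    (X 0 ^ d : MvPolynomial (Fin 2) k) ∈ twoIntervalAlgebra k a b d := by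
  have := generator_mem (k := k) (a := a) (Or.inr ⟨hbd.le, le_rfl⟩)
  simpa using this

lemma X_one_pow_mem : (X 1 ^ d : MvPolynomial (Fin 2) k) ∈ twoIntervalAlgebra k a b d := by
  have := generator_mem (k := k) (b := b) (d := d) (Or.inl (Nat.zero_le a))
  simpa using this

lemma X_pow_mul_X_pow_mem_of_eq {p q p' q' : ℕ} (hp : p = p') (hq : q = q')
    (h : (X 0 ^ p * X 1 ^ q : MvPolynomial (Fin 2) k) ∈ twoIntervalAlgebra k a b d) :
    (X 0 ^ p' * X 1 ^ q' : MvPolynomial (Fin 2) k) ∈ twoIntervalAlgebra k a b d :=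
  hp ▸ hq ▸ h

lemma X_pow_mul_X_pow_mul (p q p' q' : ℕ) :
    (X 0 ^ p * X 1 ^ q * (X 0 ^ p' * X 1 ^ q') : MvPolynomial (Fin 2) k) =
      X 0 ^ (p + p') * X 1 ^ (q + q') := by
  ring

/-- Every exponent in `[0, 2d]` is a sum of two exponents of generators. -/
lemma exists_add_eq (hbd : b < d) (h : b ≤ 2 * a + 1 ∧ 2 * b ≤ a + d + 1) {p : ℕ}
    (hp : p ≤ 2 * d) :
    ∃ s t, (s ≤ a ∨ b ≤ s ∧ s ≤ d) ∧ (t ≤ a ∨ b ≤ t ∧ t ≤ d) ∧ s + t = p := by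
  rcases le_or_gt p (2 * a) with h1 | h1
  · exact ⟨min p a, p - min p a, by omega, by omega, by omega⟩
  -- From here 2a < p, so the first inequality gives b ≤ p. Once a + d < p, the second gives 2b ≤ p.
  rcases le_or_gt p (a + d) with h2 | h2
  · exact ⟨p - max b (p - a), max b (p - a), by omega, by omega, by omega⟩
  · exact ⟨max b (p - d), p - max b (p - d), by omega, by omega, by omega⟩

/-- If the two inequalities hold, the algebra contains all forms of degree `n * d`, `n ≥ 2`. -/
lemma X_pow_mul_X_pow_mem (hbd : b < d) (had : a < d) (h : b ≤ 2 * a + 1 ∧ 2 * b ≤ a + d + 1)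
    (n : ℕ) : ∀ p q : ℕ, p + q = (n + 2) * d →
      (X 0 ^ p * X 1 ^ q : MvPolynomial (Fin 2) k) ∈ twoIntervalAlgebra k a b d := by
  induction n with
  | zero =>
    intro p q hpq
    obtain ⟨s, t, hs, ht, hst⟩ := exists_add_eq hbd h (show p ≤ 2 * d by omega)
    have := mul_mem (generator_mem (k := k) hs) (generator_mem (k := k) ht)
    rw [X_pow_mul_X_pow_mul] at this
    exact X_pow_mul_X_pow_mem_of_eq hst (by omega) this
  | succ n ih =>
    intro p q hpq
    have hnd : (n + 1 + 2) * d = (n + 2) * d + d := by ring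
    have hnd' : (n + 2) * d = n * d + 2 * d := by ring
    rcases le_or_gt d p with hp | hp
    · have := mul_mem (X_zero_pow_mem (k := k) (a := a) hbd) (ih (p - d) q (by omega))
      rwa [← mul_assoc, ← pow_add, Nat.add_sub_cancel' hp] at this
    · have := mul_mem (X_one_pow_mem (k := k) (a := a) (b := b) (d := d))
        (ih p (q - d) (by omega))
      rwa [mul_left_comm, ← pow_add, Nat.add_sub_cancel' (by omega)] at this

end Monomials

/-! ### The ideals R₊ and Q, and the reduction number. -/

section Ideals

variable {k : Type*} [Field k] {a b d : ℕ}

lemma mem_irrelevantIdeal {f : twoIntervalAlgebra k a b d} :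
    f ∈ irrelevantIdeal (twoIntervalAlgebra k a b d) ↔
      constantCoeff (f : MvPolynomial (Fin 2) k) = 0 :=
  Iff.rfl

/-- The generating monomials of the algebra, as elements of the algebra. -/
def twoIntervalGenerators (k : Type*) [Field k] (a b d : ℕ) : Set (twoIntervalAlgebra k a b d) :=
  {f | ∃ α, (α ≤ a ∨ b ≤ α ∧ α ≤ d) ∧ (f : MvPolynomial (Fin 2) k) = X 0 ^ α * X 1 ^ (d - α)}

lemma generators_subset_irrelevantIdeal (hd : 0 < d) {f : twoIntervalAlgebra k a b d}
    (hf : f ∈ twoIntervalGenerators k a b d) (had : a ≤ d) :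
    f ∈ irrelevantIdeal (twoIntervalAlgebra k a b d) := by
  obtain ⟨α, hα, h⟩ := hf
  rw [mem_irrelevantIdeal, h, map_mul, map_pow, map_pow, constantCoeff_X, constantCoeff_X,
    ← pow_add]
  exact zero_pow (by omega)

/-- Subtracting its constant term from any element of R lands in the span, by induction on the
generation of R; products use fg - f(0)g(0) = f(g - g(0)) + g(0)(f - f(0)). -/
lemma irrelevantIdeal_eq_span (hd : 0 < d) (had : a ≤ d) :
    irrelevantIdeal (twoIntervalAlgebra k a b d) = Ideal.span (twoIntervalGenerators k a b d) := by
  apply le_antisymm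
  · have key : ∀ (f : MvPolynomial (Fin 2) k) (hf : f ∈ twoIntervalAlgebra k a b d),
        (⟨f, hf⟩ - algebraMap k _ (constantCoeff f) : twoIntervalAlgebra k a b d) ∈
          Ideal.span (twoIntervalGenerators k a b d) := by
      intro f hf
      induction hf using Algebra.adjoin_induction with
      | mem f hf =>
        have hm : (⟨f, Algebra.subset_adjoin hf⟩ : twoIntervalAlgebra k a b d) ∈
            twoIntervalGenerators k a b d := by
          obtain ⟨α, hα, rfl⟩ := hf
          exact ⟨α, by simpa using hα, rfl⟩
        have h0 : constantCoeff f = 0 := generators_subset_irrelevantIdeal hd hm had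
        rw [h0, map_zero, sub_zero]
        exact Ideal.subset_span hm
      | algebraMap r =>
        convert Ideal.zero_mem _
        rw [sub_eq_zero]
        ext1
        simp [algebraMap_eq]
      | add f g hf hg ihf ihg =>
        convert Ideal.add_mem _ ihf ihg using 1
        rw [map_add, map_add, ← add_sub_add_comm]
        rfl
      | mul f g hf hg ihf ihg =>
        convert Ideal.add_mem _ (Ideal.mul_mem_left _ ⟨f, hf⟩ ihg)
          (Ideal.mul_mem_left _ (algebraMap k _ (constantCoeff g)) ihf) using 1
        rw [map_mul, map_mul]
        have : (⟨f * g, mul_mem hf hg⟩ : twoIntervalAlgebra k a b d) = ⟨f, hf⟩ * ⟨g, hg⟩ := rfl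
        rw [this]
        ring
    intro f hf
    have := key f f.2
    rwa [mem_irrelevantIdeal.1 hf, map_zero, sub_zero] at this
  · exact Ideal.span_le.2 fun f hf => generators_subset_irrelevantIdeal hd hf had

lemma parameterIdeal_eq_span_pair (hbd : b < d) :
    parameterIdeal (twoIntervalAlgebra k a b d) d =
      Ideal.span {⟨X 0 ^ d, X_zero_pow_mem hbd⟩, ⟨X 1 ^ d, X_one_pow_mem⟩} := by
  rw [parameterIdeal]
  congr 1
  ext f
  simp [Subtype.ext_iff]

lemma parameterIdeal_le_irrelevantIdeal (hbd : b < d) :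
    parameterIdeal (twoIntervalAlgebra k a b d) d ≤
      irrelevantIdeal (twoIntervalAlgebra k a b d) := by
  rw [parameterIdeal, Ideal.span_le]
  rintro f (h | h) <;>
  · rw [SetLike.mem_coe, mem_irrelevantIdeal, h, map_pow, constantCoeff_X]
    exact zero_pow (by omega)

lemma exists_of_mem_support_of_mem_pow (had : a ≤ d) (n : ℕ) :
    ∀ f ∈ irrelevantIdeal (twoIntervalAlgebra k a b d) ^ n,
      ∀ e ∈ (f : MvPolynomial (Fin 2) k).support,
      ∃ i j, n ≤ i + j ∧ e 0 + e 1 = (i + j) * d ∧ j * b ≤ e 0 ∧ e 0 ≤ j * d + i * a := by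
  classical
  induction n with
  | zero =>
    intro f _ e he
    obtain ⟨i, j, h⟩ := exists_of_mem_support f.2 he had
    exact ⟨i, j, Nat.zero_le _, h⟩
  | succ n ih =>
    intro f hf
    rw [pow_succ] at hf
    refine Submodule.mul_induction_on hf (fun g hg h hh e he => ?_) (fun g h hg hh e he => ?_)
    · obtain ⟨u, hu, v, hv, rfl⟩ := exists_add_of_mem_support_mul he
      obtain ⟨i, j, h0, h1, h2, h3⟩ := ih g hg u hu
      obtain ⟨i', j', h1', h2', h3'⟩ := exists_of_mem_support h.2 hv had
      refine ⟨i + i', j + j', ?_, ?_, ?_, ?_⟩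
      -- An element of R₊ has no constant term, so the last factor contributes degree at least 1.
      · by_contra hlt
        obtain ⟨rfl, rfl⟩ : i' = 0 ∧ j' = 0 := by omega
        have hv0 : v = 0 := by
          ext t
          fin_cases t <;> simp <;> omega
        rw [hv0, mem_support_iff] at hv
        exact hv (mem_irrelevantIdeal.1 hh)
      all_goals simp only [Finsupp.add_apply]; linarith
    · rcases Finset.mem_union.1 (support_add he) with h' | h'
      exacts [hg e h', hh e h']

/-- The first alternative comes from the multiples of y^d, which leave the x-exponent unchanged; the
second comes from those of x^d, which shift it by d. -/
lemma exists_of_mem_support_of_mem_parameterIdeal_mul (hbd : b < d) (had : a ≤ d) (n : ℕ) :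
    ∀ f ∈ parameterIdeal (twoIntervalAlgebra k a b d) d *
        irrelevantIdeal (twoIntervalAlgebra k a b d) ^ n,
      ∀ e ∈ (f : MvPolynomial (Fin 2) k).support,
      ∃ i j, n ≤ i + j ∧ e 0 + e 1 = (i + j + 1) * d ∧
        (j * b ≤ e 0 ∧ e 0 ≤ j * d + i * a ∨ d + j * b ≤ e 0 ∧ e 0 ≤ d + (j * d + i * a)) := by
  classical
  intro f hf
  have hadd : ∀ (g h : twoIntervalAlgebra k a b d) {P : (Fin 2 →₀ ℕ) → Prop},
      (∀ e ∈ (g : MvPolynomial (Fin 2) k).support, P e) →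
      (∀ e ∈ (h : MvPolynomial (Fin 2) k).support, P e) →
      ∀ e ∈ ((g + h : twoIntervalAlgebra k a b d) : MvPolynomial (Fin 2) k).support, P e := by
    intro g h P hg hh e he
    rcases Finset.mem_union.1 (support_add he) with h' | h'
    exacts [hg e h', hh e h']
  refine Submodule.mul_induction_on hf (fun g hg h hh => ?_) (fun g h => hadd g h)
  rw [parameterIdeal_eq_span_pair hbd, Ideal.mem_span_pair] at hg
  obtain ⟨r, s, rfl⟩ := hg
  rw [add_mul, mul_right_comm, mul_right_comm s]
  apply hadd
  · intro e he
    obtain ⟨u, hu, v, hv, rfl⟩ := exists_add_of_mem_support_mul he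
    obtain ⟨i, j, h0, h1, h2, h3⟩ :=
      exists_of_mem_support_of_mem_pow had n _ (Ideal.mul_mem_left _ r hh) u hu
    simp only [X_pow_eq_monomial] at hv
    rw [Finset.mem_singleton.1 (support_monomial_subset hv)]
    refine ⟨i, j, h0, ?_, Or.inr ⟨?_, ?_⟩⟩ <;> simp [add_mul] at h1 ⊢ <;> omega
  · intro e he
    obtain ⟨u, hu, v, hv, rfl⟩ := exists_add_of_mem_support_mul he
    obtain ⟨i, j, h0, h1, h2, h3⟩ :=
      exists_of_mem_support_of_mem_pow had n _ (Ideal.mul_mem_left _ s hh) u hu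
    simp only [X_pow_eq_monomial] at hv
    rw [Finset.mem_singleton.1 (support_monomial_subset hv)]
    refine ⟨i, j, h0, ?_, Or.inl ⟨?_, ?_⟩⟩ <;> simp [add_mul] at h1 ⊢ <;> omega

lemma parameterIdeal_mul_pow_le (hbd : b < d) (n : ℕ) :
    parameterIdeal (twoIntervalAlgebra k a b d) d *
        irrelevantIdeal (twoIntervalAlgebra k a b d) ^ n ≤
      irrelevantIdeal (twoIntervalAlgebra k a b d) ^ (n + 1) := by
  rw [pow_succ']
  exact Ideal.mul_mono_left (parameterIdeal_le_irrelevantIdeal hbd)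

/-- A product of three generators has x-exponent or y-exponent at least d. Dividing by x^d or y^d
leaves a monomial of degree 2d, which is a product of two generators by `exists_add_eq`. -/
lemma parameterIdeal_mul_irrelevantIdeal_sq (hbd : b < d) (had : a < d)
    (h : b ≤ 2 * a + 1 ∧ 2 * b ≤ a + d + 1) :
    parameterIdeal (twoIntervalAlgebra k a b d) d *
        irrelevantIdeal (twoIntervalAlgebra k a b d) ^ 2 =
      irrelevantIdeal (twoIntervalAlgebra k a b d) ^ (2 + 1) := by
  refine le_antisymm (parameterIdeal_mul_pow_le hbd 2) ?_
  have hd : 0 < d := by omega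
  have hgen : ∀ {s : ℕ} (hs : s ≤ a ∨ b ≤ s ∧ s ≤ d),
      (⟨_, generator_mem hs⟩ : twoIntervalAlgebra k a b d) ∈
        irrelevantIdeal (twoIntervalAlgebra k a b d) := fun {s} hs =>
    generators_subset_irrelevantIdeal hd ⟨s, hs, rfl⟩ had.le
  have hsplit : ∀ p q, p + q = 2 * d → ∃ g ∈ irrelevantIdeal (twoIntervalAlgebra k a b d) ^ 2,
      (g : MvPolynomial (Fin 2) k) = X 0 ^ p * X 1 ^ q := by
    intro p q hpq
    obtain ⟨s, t, hs, ht, hst⟩ := exists_add_eq hbd h (show p ≤ 2 * d by omega)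
    refine ⟨_, (pow_two (irrelevantIdeal (twoIntervalAlgebra k a b d))).symm ▸
      Ideal.mul_mem_mul (hgen hs) (hgen ht), ?_⟩
    change X 0 ^ s * X 1 ^ (d - s) * (X 0 ^ t * X 1 ^ (d - t)) = _
    rw [X_pow_mul_X_pow_mul, hst]
    congr 2
    omega
  conv_lhs => rw [pow_succ, pow_two]
  conv_lhs => rw [irrelevantIdeal_eq_span hd had.le]
  rw [Ideal.span_mul_span', Ideal.span_mul_span', Ideal.span_le]
  rintro _ ⟨_, ⟨f, ⟨s, hs, hf⟩, g, ⟨t, ht, hg⟩, rfl⟩, h, ⟨u, hu, hh⟩, rfl⟩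
  have hval : ((f * g * h : twoIntervalAlgebra k a b d) : MvPolynomial (Fin 2) k) =
      X 0 ^ (s + t + u) * X 1 ^ (3 * d - (s + t + u)) := by
    rw [show 3 * d - (s + t + u) = (d - s) + (d - t) + (d - u) by omega]
    simp only [MulMemClass.coe_mul, hf, hg, hh]
    ring
  rcases le_or_gt d (s + t + u) with hp | hp
  · obtain ⟨g', hg', hv⟩ := hsplit (s + t + u - d) (3 * d - (s + t + u)) (by omega)
    have hx : (⟨X 0 ^ d, X_zero_pow_mem hbd⟩ : twoIntervalAlgebra k a b d) ∈
      parameterIdeal (twoIntervalAlgebra k a b d) d := Ideal.subset_span (Or.inl rfl)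
    refine (congrArg (· ∈ _) (Subtype.ext ?_)).mpr (Ideal.mul_mem_mul hx hg')
    rw [hval, MulMemClass.coe_mul, hv, ← mul_assoc, ← pow_add, Nat.add_sub_cancel' hp]
  · obtain ⟨g', hg', hv⟩ := hsplit (s + t + u) (2 * d - (s + t + u)) (by omega)
    have hy : (⟨X 1 ^ d, X_one_pow_mem⟩ : twoIntervalAlgebra k a b d) ∈
      parameterIdeal (twoIntervalAlgebra k a b d) d := Ideal.subset_span (Or.inr rfl)
    refine (congrArg (· ∈ _) (Subtype.ext ?_)).mpr (Ideal.mul_mem_mul hy hg')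
    rw [hval, MulMemClass.coe_mul, hv, mul_left_comm, ← pow_add]
    congr 2
    omega

/-- A product of `n + 1` generators in an equality `Q * R₊ ^ n = R₊ ^ (n + 1)`. -/
lemma exists_of_parameterIdeal_mul_pow_eq (hbd : b < d) (had : a ≤ d) {n : ℕ}
    (h : parameterIdeal (twoIntervalAlgebra k a b d) d *
        irrelevantIdeal (twoIntervalAlgebra k a b d) ^ n =
      irrelevantIdeal (twoIntervalAlgebra k a b d) ^ (n + 1)) (s : Fin (n + 1) → ℕ)
    (hs : ∀ t, s t ≤ a ∨ b ≤ s t ∧ s t ≤ d) {p : ℕ} (hp : ∑ t, s t = p) :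
    ∃ i j, i + j = n ∧
      (j * b ≤ p ∧ p ≤ j * d + i * a ∨ d + j * b ≤ p ∧ p ≤ d + (j * d + i * a)) := by
  subst hp
  have hd : 0 < d := by omega
  have hmem : ∏ t, (⟨_, generator_mem (hs t)⟩ : twoIntervalAlgebra k a b d) ∈
      irrelevantIdeal (twoIntervalAlgebra k a b d) ^ (n + 1) := by
    have := Ideal.prod_mem_prod (s := Finset.univ)
      (I := fun _ : Fin (n + 1) => irrelevantIdeal (twoIntervalAlgebra k a b d))
      (x := fun t => ⟨_, generator_mem (hs t)⟩)
      fun t _ => generators_subset_irrelevantIdeal hd ⟨s t, hs t, rfl⟩ had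
    simpa using this
  rw [← h] at hmem
  have hval : ((∏ t, (⟨_, generator_mem (hs t)⟩ : twoIntervalAlgebra k a b d) :
      twoIntervalAlgebra k a b d) : MvPolynomial (Fin 2) k) =
      X 0 ^ (∑ t, s t) * X 1 ^ (∑ t, (d - s t)) := by
    rw [SubmonoidClass.coe_finsetProd, Finset.prod_mul_distrib, Finset.prod_pow_eq_pow_sum,
      Finset.prod_pow_eq_pow_sum]
  obtain ⟨i, j, -, h1, h2⟩ := exists_of_mem_support_of_mem_parameterIdeal_mul hbd had n _ hmem _
    (hval ▸ mem_support_X_pow_mul_X_pow _ _)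
  simp only [Finsupp.add_apply, Finsupp.single_apply, if_true] at h1 h2
  simp only [Fin.isValue, one_ne_zero, if_false, add_zero, zero_ne_one, zero_add] at h1 h2
  refine ⟨i, j, ?_, h2⟩
  have hsum : ∑ t, s t + ∑ t, (d - s t) = (n + 1) * d := by
    rw [← Finset.sum_add_distrib, Finset.sum_congr rfl fun t _ =>
      Nat.add_sub_cancel' (show s t ≤ d by have := hs t; omega)]
    simp
  -- Comparing total degrees turns the bound n ≤ i + j into an equality.
  have := Nat.eq_of_mul_eq_mul_right hd (h1.symm.trans hsum)
  omega

lemma reductionNumber_eq_two_iff (ha : 1 ≤ a) (hab : a + 2 ≤ b) (hbd : b < d) :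
    IsReduction (parameterIdeal (twoIntervalAlgebra k a b d) d)
          (irrelevantIdeal (twoIntervalAlgebra k a b d)) ∧
        reductionNumber (parameterIdeal (twoIntervalAlgebra k a b d) d)
          (irrelevantIdeal (twoIntervalAlgebra k a b d)) = 2 ↔
      b ≤ 2 * a + 1 ∧ 2 * b ≤ a + d + 1 := by
  have had : a < d := by omega
  constructor
  · rintro ⟨⟨-, hne⟩, hr⟩
    -- The set is nonempty, so its infimum is attained and the value 2 yields QR₊² = R₊³.
    have h2 := Nat.sInf_mem (s := {r | parameterIdeal (twoIntervalAlgebra k a b d) d *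
        irrelevantIdeal (twoIntervalAlgebra k a b d) ^ r =
      irrelevantIdeal (twoIntervalAlgebra k a b d) ^ (r + 1)}) hne
    rw [show sInf _ = 2 from hr] at h2
    constructor
    · by_contra hlt
      -- If 2a + 1 < b, the exponent 2a + 1 falls in the gap after [0, 2a] and is too small to
      -- contain x^d.
      obtain ⟨i, j, hij, h⟩ := exists_of_parameterIdeal_mul_pow_eq hbd had.le h2 ![a, a, 1]
        (by intro t; fin_cases t <;> simp; omega)
        (p := a + a + 1) (by simp [Fin.sum_univ_succ]; omega)
      obtain ⟨rfl, rfl⟩ | ⟨rfl, rfl⟩ | ⟨rfl, rfl⟩ :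
        i = 0 ∧ j = 2 ∨ i = 1 ∧ j = 1 ∨ i = 2 ∧ j = 0 := by omega
      all_goals omega
    · by_contra hlt
      -- Mirror image of the previous case under exchanging x and y: removing x^d leaves 2b - 1, in
      -- the gap between a + d and 2b.
      obtain ⟨i, j, hij, h⟩ := exists_of_parameterIdeal_mul_pow_eq hbd had.le h2 ![b, b, d - 1]
        (by intro t; fin_cases t <;> simp <;> omega)
        (p := b + b + (d - 1)) (by simp [Fin.sum_univ_succ]; omega)
      obtain ⟨rfl, rfl⟩ | ⟨rfl, rfl⟩ | ⟨rfl, rfl⟩ :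
        i = 0 ∧ j = 2 ∨ i = 1 ∧ j = 1 ∨ i = 2 ∧ j = 0 := by omega
      all_goals omega
  · intro h
    have h2 := parameterIdeal_mul_irrelevantIdeal_sq (k := k) hbd had h
    refine ⟨⟨parameterIdeal_le_irrelevantIdeal hbd, 2, h2⟩, ?_⟩
    refine le_antisymm (Nat.sInf_le h2) (le_csInf ⟨2, h2⟩ fun r hr => ?_)
    by_contra hlt
    obtain rfl | rfl : r = 0 ∨ r = 1 := by omega
    · obtain ⟨i, j, hij, h⟩ := exists_of_parameterIdeal_mul_pow_eq hbd had.le hr ![1]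
        (by intro t; fin_cases t; simp; omega)
        (p := 1) (by simp)
      obtain ⟨rfl, rfl⟩ : i = 0 ∧ j = 0 := by omega
      omega
    -- The exponent a + 1 lies in the gap between a and b, which is nonempty because a + 2 ≤ b.
    · obtain ⟨i, j, hij, h⟩ := exists_of_parameterIdeal_mul_pow_eq hbd had.le hr ![a, 1]
        (by intro t; fin_cases t <;> simp; omega)
        (p := a + 1) (by simp [Fin.sum_univ_succ])
      obtain ⟨rfl, rfl⟩ | ⟨rfl, rfl⟩ : i = 0 ∧ j = 1 ∨ i = 1 ∧ j = 0 := by omega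
      all_goals omega

end Ideals

/-! ### The local ring at R₊: dimension and the Buchsbaum property. -/

section LocalRing

variable {k : Type*} [Field k] {a b d : ℕ}

instance isNoetherianRing_twoIntervalAlgebra :
    IsNoetherianRing (twoIntervalAlgebra k a b d) := by
  have hfin : (twoIntervalMonomials k a b d).Finite := by
    refine ((Set.finite_Icc 0 a).union (Set.finite_Icc b d)).image
      (fun α => (X 0 ^ α * X 1 ^ (d - α) : MvPolynomial (Fin 2) k)) |>.subset ?_
    rintro _ ⟨α, hα, rfl⟩
    exact ⟨α, hα, rfl⟩
  have hfg : (twoIntervalAlgebra k a b d).FG := Subalgebra.fg_def.2 ⟨_, hfin, rfl⟩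
  have : Algebra.FiniteType k (twoIntervalAlgebra k a b d) :=
    (Subalgebra.fg_iff_finiteType _).1 hfg
  exact Algebra.FiniteType.isNoetherianRing k _

/-- The irrelevant ideal is contained in the radical of `(x ^ N, y ^ N)`. -/
lemma irrelevantIdeal_le_radical (hd : 0 < d) (had : a ≤ d) {N : ℕ}
    {x y : twoIntervalAlgebra k a b d} (hx : (x : MvPolynomial (Fin 2) k) = X 0 ^ N)
    (hy : (y : MvPolynomial (Fin 2) k) = X 1 ^ N) :
    irrelevantIdeal (twoIntervalAlgebra k a b d) ≤ (Ideal.span {x, y}).radical := by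
  rw [irrelevantIdeal_eq_span hd had, Ideal.span_le]
  rintro f ⟨α, hα, hf⟩
  refine ⟨N, ?_⟩
  have hfN : f ^ N = x ^ α * y ^ (d - α) := by
    ext1
    simp only [SubmonoidClass.coe_pow, MulMemClass.coe_mul, hf, hx, hy]
    ring
  rw [hfN]
  rcases Nat.eq_zero_or_pos α with h0 | h0
  · exact Ideal.mul_mem_left _ _ (Ideal.pow_mem_of_mem _ (Ideal.subset_span (by simp)) _
      (by omega))
  · exact Ideal.mul_mem_right _ _ (Ideal.pow_mem_of_mem _ (Ideal.subset_span (by simp)) _ h0)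

/-- Krull's height theorem for (x^d, y^d) gives the upper bound. For the lower bound, the kernel of
y ↦ 0 lies strictly between 0 and R₊: it contains y^d but not x^d. -/
lemma height_irrelevantIdeal (hbd : b < d) (had : a ≤ d) :
    (irrelevantIdeal (twoIntervalAlgebra k a b d)).height = 2 := by
  have hd : 0 < d := by omega
  let x : twoIntervalAlgebra k a b d := ⟨X 0 ^ d, X_zero_pow_mem hbd⟩
  let y : twoIntervalAlgebra k a b d := ⟨X 1 ^ d, X_one_pow_mem⟩
  apply le_antisymm
  · have hmin : irrelevantIdeal (twoIntervalAlgebra k a b d) ∈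
        (Ideal.span {x, y}).minimalPrimes := by
      refine ⟨⟨inferInstance, ?_⟩, fun J hJ _ => ?_⟩
      · have := parameterIdeal_le_irrelevantIdeal (k := k) (a := a) hbd
        rwa [parameterIdeal_eq_span_pair hbd] at this
      · have := hJ.1
        exact (irrelevantIdeal_le_radical hd had (x := x) (y := y) rfl rfl).trans
          ((Ideal.IsPrime.radical_le_iff this).2 hJ.2)
    refine (Ideal.height_le_card_of_mem_minimalPrimes_span (Set.toFinite _) hmin).trans ?_
    have := Set.ncard_insert_le x {y}
    rw [Set.ncard_singleton] at this
    exact_mod_cast this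
  · let φ : MvPolynomial (Fin 2) k →+* MvPolynomial (Fin 2) k :=
      (aeval ![X 0, 0] : MvPolynomial (Fin 2) k →ₐ[k] MvPolynomial (Fin 2) k).toRingHom
    let ψ : twoIntervalAlgebra k a b d →+* MvPolynomial (Fin 2) k :=
      φ.comp (twoIntervalAlgebra k a b d).val.toRingHom
    have hφ : (constantCoeff : MvPolynomial (Fin 2) k →+* k).comp φ = constantCoeff := by
      apply MvPolynomial.ringHom_ext
      · intro r
        simp [φ]
      · intro i
        fin_cases i <;> simp [φ]
    have hprime : (RingHom.ker ψ).IsPrime := RingHom.ker_isPrime ψ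
    have hx : ψ x = X 0 ^ d := by simp [ψ, φ, x]
    have hy : ψ y = 0 := by simp [ψ, φ, y, hd.ne']
    have h1 : (⊥ : Ideal (twoIntervalAlgebra k a b d)) < RingHom.ker ψ := by
      refine bot_lt_iff_ne_bot.2 fun h => ?_
      have : y ∈ RingHom.ker ψ := hy
      rw [h, Ideal.mem_bot] at this
      exact pow_ne_zero d (X_ne_zero (R := k) (1 : Fin 2)) (congrArg Subtype.val this)
    have h2 : RingHom.ker ψ < irrelevantIdeal (twoIntervalAlgebra k a b d) := by
      refine lt_of_le_of_ne (fun f hf => ?_) fun h => ?_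
      · rw [mem_irrelevantIdeal, ← hφ, RingHom.comp_apply]
        exact (congrArg constantCoeff (show ψ f = 0 from hf)).trans (map_zero _)
      · have : x ∈ RingHom.ker ψ := by
          rw [h, mem_irrelevantIdeal]
          simp [x, hd.ne']
        exact pow_ne_zero d (X_ne_zero (R := k) (0 : Fin 2)) (hx.symm.trans this)
    have h3 := Ideal.height_add_one_le_of_lt_of_isPrime h1
    have h4 := Ideal.height_add_one_le_of_lt_of_isPrime h2
    calc (2 : ℕ∞) = 0 + 1 + 1 := by norm_num
      _ ≤ (⊥ : Ideal (twoIntervalAlgebra k a b d)).height + 1 + 1 := by gcongr; exact bot_le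
      _ ≤ (RingHom.ker ψ).height + 1 := by gcongr
      _ ≤ _ := h4

lemma ringKrullDim_localization (hbd : b < d) (had : a ≤ d) (A : Type*) [CommRing A]
    [Algebra (twoIntervalAlgebra k a b d) A]
    [IsLocalization.AtPrime A (irrelevantIdeal (twoIntervalAlgebra k a b d))] :
    ringKrullDim A = (2 : ℕ) := by
  rw [IsLocalization.AtPrime.ringKrullDim_eq_height
    (irrelevantIdeal (twoIntervalAlgebra k a b d)) A, height_irrelevantIdeal hbd had]
  rfl

lemma range_fin_two {A : Type*} (x : Fin 2 → A) : Set.range x = {x 0, x 1} := by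
  ext z
  simp [eq_comm]

/-- The first member of a system of parameters of length two is nonzero. -/
lemma IsSystemOfParameters.ne_zero {A : Type*} [CommRing A] [IsLocalRing A] [IsNoetherianRing A]
    {x : Fin 2 → A} (hx : IsSystemOfParameters x) : x 0 ≠ 0 := by
  intro h0
  have hspan : Ideal.span (Set.range x) = Ideal.span {x 1} := by
    rw [range_fin_two, h0, Ideal.span_insert_zero]
  -- Otherwise the maximal ideal, of height 2, would be minimal over a principal ideal.
  have hmin : IsLocalRing.maximalIdeal A ∈ (Ideal.span {x 1}).minimalPrimes := by
    rw [← hspan]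
    refine ⟨⟨inferInstance, hx.2 ▸ Ideal.le_radical⟩, fun J hJ _ => ?_⟩
    rw [← hx.2]
    exact (Ideal.IsPrime.radical_le_iff hJ.1).2 hJ.2
  have h1 := Ideal.height_le_card_of_mem_minimalPrimes_span (Set.toFinite _) hmin
  have h2 := IsLocalRing.maximalIdeal_height_eq_ringKrullDim (R := A)
  rw [hx.1] at h2
  rw [Set.ncard_singleton] at h1
  have h3 : (IsLocalRing.maximalIdeal A).height = (2 : ℕ) := WithBot.coe_injective h2
  rw [h3] at h1
  exact absurd h1 (by norm_num)

/-- If the two inequalities hold, `R₊` multiplies into `R` every polynomial `v` with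
`x ^ N * v ∈ R`, `d ∣ N`. -/
lemma mul_mem_of_X_pow_mul_mem (hbd : b < d) (had : a < d)
    (h : b ≤ 2 * a + 1 ∧ 2 * b ≤ a + d + 1) {v : MvPolynomial (Fin 2) k} {N : ℕ}
    (hv : X 0 ^ (d * N) * v ∈ twoIntervalAlgebra k a b d) {r : twoIntervalAlgebra k a b d}
    (hr : r ∈ irrelevantIdeal (twoIntervalAlgebra k a b d)) :
    (r : MvPolynomial (Fin 2) k) * v ∈ twoIntervalAlgebra k a b d := by
  refine mem_of_forall_monomial_mem fun e he => ?_
  obtain ⟨u, hu, w, hw, rfl⟩ := exists_add_of_mem_support_mul he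
  -- Multiplication by x^(dN) shifts degrees by a multiple of d, so v too has only degrees divisible
  -- by d. Its nonconstant part is moved by R₊ into degrees at least 2d.
  have hdvd : d ∣ w 0 + w 1 := by
    have hw' : Finsupp.single 0 (d * N) + w ∈ (X 0 ^ (d * N) * v).support := by
      rw [mem_support_iff, X_pow_eq_monomial, coeff_monomial_mul, one_mul]
      exact mem_support_iff.1 hw
    obtain ⟨i, j, hij, -⟩ := exists_of_mem_support hv hw' had.le
    simp only [Finsupp.add_apply, Finsupp.single_eq_same] at hij
    rw [Finsupp.single_eq_of_ne (by decide), zero_add, add_assoc] at hij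
    exact (Nat.dvd_add_right (dvd_mul_right d N)).1 (hij ▸ dvd_mul_left d _)
  obtain ⟨i, j, h1, h2, -⟩ :=
    exists_of_mem_support_of_mem_pow had.le 1 r (by rwa [pow_one]) u hu
  obtain ⟨m, hm⟩ := hdvd
  rcases Nat.eq_zero_or_pos m with rfl | hm0
  · have hw0 : w = 0 := by
      ext t
      fin_cases t <;> simp <;> omega
    rw [hw0, add_zero]
    exact monomial_mem_of_mem_support r.2 hu
  · obtain ⟨n, hn⟩ : ∃ n, i + j + m = n + 2 := ⟨i + j + m - 2, by omega⟩
    refine X_pow_mul_X_pow_mem hbd had h n _ _ ?_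
    rw [← hn, add_mul, ← h2, mul_comm m, ← hm]
    simp only [Finsupp.add_apply]
    ring

lemma isBuchsbaumLocalRing_of_inequalities (hbd : b < d) (had : a < d)
    (h : b ≤ 2 * a + 1 ∧ 2 * b ≤ a + d + 1) (A : Type*) [CommRing A] [IsLocalRing A]
    [Algebra (twoIntervalAlgebra k a b d) A]
    [IsLocalization.AtPrime A (irrelevantIdeal (twoIntervalAlgebra k a b d))] :
    IsBuchsbaumLocalRing A := by
  let P := irrelevantIdeal (twoIntervalAlgebra k a b d)
  have hP : P.primeCompl ≤ nonZeroDivisors _ := P.primeCompl_le_nonZeroDivisors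
  have hdom : IsDomain A := IsLocalization.isDomain_of_le_nonZeroDivisors _ hP
  have hinj : Function.Injective (algebraMap (twoIntervalAlgebra k a b d) A) :=
    IsLocalization.injective A hP
  have hnoeth : IsNoetherianRing A := IsLocalization.isNoetherianRing P.primeCompl A inferInstance
  have hd : 0 < d := by omega
  refine ⟨hnoeth, fun n x hx => ?_⟩
  obtain rfl : n = 2 := by
    have h1 := hx.1.symm.trans (ringKrullDim_localization (k := k) hbd had.le A)
    exact_mod_cast h1
  have hx0 := hx.ne_zero
  intro i y hy m hm
  fin_cases i
  · have hI : x '' Set.Iio (0 : Fin 2) = ∅ := by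
      ext; simp
    change x 0 * y ∈ Ideal.span (x '' Set.Iio (0 : Fin 2)) at hy
    change m * y ∈ Ideal.span (x '' Set.Iio (0 : Fin 2))
    rw [hI, Ideal.span_empty, Ideal.mem_bot] at hy ⊢
    rw [(mul_eq_zero.1 hy).resolve_left hx0, mul_zero]
  · have hI : x '' Set.Iio (1 : Fin 2) = {x 0} := by
      rw [show Set.Iio (1 : Fin 2) = {0} by ext t; fin_cases t <;> simp, Set.image_singleton]
    change x 1 * y ∈ Ideal.span (x '' Set.Iio (1 : Fin 2)) at hy
    change m * y ∈ Ideal.span (x '' Set.Iio (1 : Fin 2))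
    rw [hI, Ideal.mem_span_singleton'] at hy
    rw [hI, Ideal.mem_span_singleton]
    obtain ⟨w, hw⟩ := hy
    -- Both x₀ and x₁ carry the fraction y/x₀ into A, hence so does some power of each element of P.
    have hpow : ∀ f ∈ P, ∃ N, ∃ p : A, y * algebraMap _ A f ^ N = x 0 * p := by
      intro f hf
      have hfm : algebraMap _ A f ∈ (Ideal.span (Set.range x)).radical := by
        rw [hx.2]
        exact (IsLocalization.AtPrime.to_map_mem_maximal_iff A P f).2 hf
      rw [range_fin_two] at hfm
      obtain ⟨N, hN⟩ := hfm
      obtain ⟨α, β, hαβ⟩ := Ideal.mem_span_pair.1 hN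
      refine ⟨N, α * y + β * w, ?_⟩
      rw [← hαβ]
      linear_combination (-β) * hw
    let X0 : twoIntervalAlgebra k a b d := ⟨X 0 ^ d, X_zero_pow_mem hbd⟩
    let X1 : twoIntervalAlgebra k a b d := ⟨X 1 ^ d, X_one_pow_mem⟩
    have hX0 : X0 ∈ P := parameterIdeal_le_irrelevantIdeal hbd (Ideal.subset_span (Or.inl rfl))
    have hX1 : X1 ∈ P := parameterIdeal_le_irrelevantIdeal hbd (Ideal.subset_span (Or.inr rfl))
    obtain ⟨N, p, hp⟩ := hpow X0 hX0
    obtain ⟨M, q, hq⟩ := hpow X1 hX1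
    obtain ⟨⟨p', s⟩, hs⟩ := IsLocalization.surj P.primeCompl p
    obtain ⟨⟨q', t⟩, ht⟩ := IsLocalization.surj P.primeCompl q
    obtain ⟨⟨r, u⟩, hu⟩ := IsLocalization.surj P.primeCompl m
    dsimp only at hs ht hu
    have hr : r ∈ P := by
      rw [← IsLocalization.AtPrime.to_map_mem_maximal_iff A P r, ← hu]
      exact Ideal.mul_mem_right _ _ hm
    -- Two expressions for y/x₀, with denominators x^(dN) and y^(dM), are compared after clearing
    -- the denominators of p and q.
    have hR : X0 ^ N * (q' * s) = X1 ^ M * (p' * t) := by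
      apply hinj
      simp only [map_mul, map_pow, ← hs, ← ht]
      apply mul_left_cancel₀ hx0
      linear_combination (algebraMap _ A (s : twoIntervalAlgebra k a b d)) *
        (algebraMap _ A (t : twoIntervalAlgebra k a b d)) *
        (algebraMap _ A X1 ^ M * hp - algebraMap _ A X0 ^ N * hq)
    have hpoly : (X 0 : MvPolynomial (Fin 2) k) ^ (d * N) ∣
        X 1 ^ (d * M) * ((p' * t : twoIntervalAlgebra k a b d) : MvPolynomial (Fin 2) k) := by
      refine ⟨((q' * s : twoIntervalAlgebra k a b d) : MvPolynomial (Fin 2) k), ?_⟩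
      have := congrArg Subtype.val hR
      rw [pow_mul, pow_mul]
      exact this.symm
    -- Since x is prime and does not divide y, x^(dN) divides p't; the quotient v equals st·y/x₀ and
    -- is thus a polynomial.
    obtain ⟨v, hv⟩ := X_prime.pow_dvd_of_dvd_mul_left _
      (fun hdvd => by
        have := (X_dvd_X (R := k)).1 (X_prime.dvd_of_dvd_pow hdvd)
        exact absurd this (by decide)) hpoly
    have hc : (r : MvPolynomial (Fin 2) k) * v ∈ twoIntervalAlgebra k a b d :=
      mul_mem_of_X_pow_mul_mem hbd had h (N := N) (hv ▸ (p' * t).2) hr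
    have hfac : p' * t * r = X0 ^ N * ⟨_, hc⟩ := by
      ext1
      change ((p' * t : twoIntervalAlgebra k a b d) : MvPolynomial (Fin 2) k) *
          (r : MvPolynomial (Fin 2) k) =
        (X 0 ^ d) ^ N * ((r : MvPolynomial (Fin 2) k) * v)
      rw [hv, pow_mul]
      ring
    have hX0ne : algebraMap _ A X0 ^ N ≠ 0 := by
      refine pow_ne_zero _ fun h0 => ?_
      exact pow_ne_zero d (X_ne_zero (R := k) (0 : Fin 2))
        (congrArg Subtype.val (hinj (h0.trans (map_zero _).symm)))
    have hunit : IsUnit (algebraMap _ A (u * s * t : twoIntervalAlgebra k a b d)) :=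
      IsLocalization.map_units A (u * s * t)
    -- Up to the unit ust, the quotient of my by x₀ is rv, which lies in R.
    rw [← hunit.dvd_mul_right]
    refine ⟨algebraMap (twoIntervalAlgebra k a b d) A ⟨_, hc⟩, ?_⟩
    apply mul_left_cancel₀ hX0ne
    have hfac' := congrArg (algebraMap _ A) hfac
    simp only [map_mul, map_pow, ← hs, ← hu] at hfac' ⊢
    linear_combination (m * (algebraMap _ A (u : twoIntervalAlgebra k a b d)) *
      (algebraMap _ A (s : twoIntervalAlgebra k a b d)) *
      (algebraMap _ A (t : twoIntervalAlgebra k a b d))) * hp + x 0 * hfac'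

/-- Since 1 ≤ a and b ≤ d - 1, both xy^(d-1) and x^(d-1)y lie in R. The first monomial is
(x^(d-1)y)^(d-p)·(x^d)^(p+1), and the second is (xy^(d-1))^p·(y^d)^(d+1-p); this is where d² comes
from. -/
lemma X_pow_add_mul_X_pow_mem (ha : 1 ≤ a) (hbd : b < d) {p : ℕ} (hp : p ≤ d) :
    (X 0 ^ (d * d + p) * X 1 ^ (d - p) : MvPolynomial (Fin 2) k) ∈ twoIntervalAlgebra k a b d ∧
    (X 0 ^ p * X 1 ^ (d * d + (d - p)) : MvPolynomial (Fin 2) k) ∈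
      twoIntervalAlgebra k a b d := by
  have hd : 1 ≤ d := by omega
  have hdp : p ≤ d + 1 := by omega
  constructor
  · have h1 := pow_mem (generator_mem (k := k) (a := a) (b := b) (d := d) (α := d - 1)
      (by omega)) (d - p)
    have := mul_mem h1 (pow_mem (X_zero_pow_mem (k := k) (a := a) hbd) (p + 1))
    have he : (d - 1) * (d - p) + d * (p + 1) = d * d + p := by
      zify [hd, hp]; ring
    rw [show d - (d - 1) = 1 by omega] at this
    convert this using 1
    rw [← he]
    ring
  · have h1 := pow_mem (generator_mem (k := k) (a := a) (b := b) (d := d) (α := 1)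
      (by omega)) p
    have := mul_mem h1 (pow_mem (X_one_pow_mem (k := k) (a := a) (b := b) (d := d)) (d + 1 - p))
    have he : (d - 1) * p + d * (d + 1 - p) = d * d + (d - p) := by
      zify [hd, hp, hdp]; ring
    convert this using 1
    rw [← he]
    ring

/-- In the Buchsbaum case, `R₊` multiplies all forms of degree `d` into the algebra. -/
lemma IsBuchsbaumLocalRing.exists_of_le (ha : 1 ≤ a) (hbd : b < d) (had : a < d)
    {A : Type*} [CommRing A] [IsLocalRing A] [Algebra (twoIntervalAlgebra k a b d) A]
    [IsLocalization.AtPrime A (irrelevantIdeal (twoIntervalAlgebra k a b d))]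
    (hB : IsBuchsbaumLocalRing A) {s p : ℕ}
    (hs : s ≤ a ∨ b ≤ s ∧ s ≤ d) (hp : p ≤ d) :
    ∃ i j, i + j = 2 ∧ j * b ≤ s + p ∧ s + p ≤ j * d + i * a := by
  let P := irrelevantIdeal (twoIntervalAlgebra k a b d)
  have hinj : Function.Injective (algebraMap (twoIntervalAlgebra k a b d) A) :=
    IsLocalization.injective A P.primeCompl_le_nonZeroDivisors
  have hd : 0 < d := by omega
  let x : twoIntervalAlgebra k a b d :=
    ⟨X 0 ^ (d * d), by rw [pow_mul]; exact pow_mem (X_zero_pow_mem hbd) d⟩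
  let y : twoIntervalAlgebra k a b d :=
    ⟨X 1 ^ (d * d), by rw [pow_mul]; exact pow_mem X_one_pow_mem d⟩
  have hx : x ∈ P := by
    rw [mem_irrelevantIdeal]
    simp [x, hd.ne']
  have hy : y ∈ P := by
    rw [mem_irrelevantIdeal]
    simp [y, hd.ne']
  have hmem : ∀ f, algebraMap _ A f ∈ IsLocalRing.maximalIdeal A ↔ f ∈ P :=
    fun f => IsLocalization.AtPrime.to_map_mem_maximal_iff A P f
  have hsop : IsSystemOfParameters ![algebraMap _ A x, algebraMap _ A y] := by
    refine ⟨ringKrullDim_localization (k := k) hbd had.le A, ?_⟩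
    have hspan : Ideal.span (Set.range ![algebraMap _ A x, algebraMap _ A y]) =
        (Ideal.span {x, y}).map (algebraMap _ A) := by
      rw [Ideal.map_span, Set.image_pair, range_fin_two]
      rfl
    rw [hspan]
    apply le_antisymm
    · rw [Ideal.IsPrime.radical_le_iff inferInstance, Ideal.map_span, Set.image_pair,
        Ideal.span_le]
      rintro _ (rfl | rfl)
      exacts [(hmem x).2 hx, (hmem y).2 hy]
    · rw [← IsLocalization.AtPrime.map_eq_maximalIdeal P A]
      exact (Ideal.map_mono (irrelevantIdeal_le_radical hd had.le rfl rfl)).trans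
        (Ideal.map_radical_le _)
  obtain ⟨hxv, hyv⟩ := X_pow_add_mul_X_pow_mem (k := k) ha hbd hp
  -- The colon element is x^(d²) times the possibly missing monomial x^p y^(d-p).
  have hweak := hB.2 2 _ hsop 1 (algebraMap (twoIntervalAlgebra k a b d) A ⟨_, hxv⟩)
  rw [show Set.Iio (1 : Fin 2) = {0} by ext t; fin_cases t <;> simp, Set.image_singleton] at hweak
  simp only [Matrix.cons_val_zero, Matrix.cons_val_one] at hweak
  have hgen : (⟨_, generator_mem hs⟩ : twoIntervalAlgebra k a b d) ∈ P :=
    generators_subset_irrelevantIdeal hd ⟨s, hs, rfl⟩ had.le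
  have key := hweak (by
    rw [Ideal.mem_span_singleton', ← map_mul]
    refine ⟨algebraMap (twoIntervalAlgebra k a b d) A ⟨_, hyv⟩, ?_⟩
    rw [← map_mul]
    congr 1
    ext1
    change X 0 ^ p * X 1 ^ (d * d + (d - p)) * X 0 ^ (d * d) =
      X 1 ^ (d * d) * (X 0 ^ (d * d + p) * X 1 ^ (d - p))
    ring) _ ((hmem _).2 hgen)
  obtain ⟨c, hc⟩ := Ideal.mem_span_singleton'.1 key
  obtain ⟨⟨r, t⟩, hrt⟩ := IsLocalization.surj P.primeCompl c
  dsimp only at hrt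
  have hR : r * x = (⟨_, generator_mem hs⟩ * ⟨_, hxv⟩) * t := by
    apply hinj
    rw [map_mul, map_mul, map_mul, ← hrt, ← hc]
    ring
  have hpoly : (r : MvPolynomial (Fin 2) k) =
      X 0 ^ (s + p) * X 1 ^ (d - s + (d - p)) * ((t : twoIntervalAlgebra k a b d) : MvPolynomial (Fin 2) k) := by
    have h1 := congrArg Subtype.val hR
    change (r : MvPolynomial (Fin 2) k) * X 0 ^ (d * d) =
      X 0 ^ s * X 1 ^ (d - s) * (X 0 ^ (d * d + p) * X 1 ^ (d - p)) *
        ((t : twoIntervalAlgebra k a b d) : MvPolynomial (Fin 2) k) at h1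
    apply mul_right_cancel₀ (pow_ne_zero (d * d) (X_ne_zero (R := k) (0 : Fin 2)))
    rw [h1]
    ring
  have hsupp : (Finsupp.single 0 (s + p) + Finsupp.single 1 (d - s + (d - p)) : Fin 2 →₀ ℕ) ∈
      (r : MvPolynomial (Fin 2) k).support := by
    have hcoeff := coeff_monomial_mul 0
      (Finsupp.single 0 (s + p) + Finsupp.single 1 (d - s + (d - p)) : Fin 2 →₀ ℕ) (1 : k)
      ((t : twoIntervalAlgebra k a b d) : MvPolynomial (Fin 2) k)
    rw [add_zero, one_mul] at hcoeff
    rw [mem_support_iff, hpoly, X_pow_mul_X_pow_eq_monomial, hcoeff]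
    -- Since t lies outside R₊, its constant term is nonzero, so the product monomial itself occurs
    -- in r ∈ R.
    exact fun h0 => t.2 (mem_irrelevantIdeal.2 h0)
  obtain ⟨i, j, h1, h2⟩ := exists_of_mem_support r.2 hsupp had.le
  simp only [Finsupp.add_apply, Finsupp.single_apply, if_true] at h1 h2
  simp only [Fin.isValue, one_ne_zero, if_false, add_zero, zero_ne_one, zero_add] at h1 h2
  have hsd : s ≤ d := by omega
  exact ⟨i, j, Nat.eq_of_mul_eq_mul_right hd (by omega), h2⟩

/-- Multiplying the missing monomials by y^d (s = 0) and by x^d (s = d) reaches the exponents 2a + 1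
and a + d + 1, the first ones after [0, 2a] and [b, a + d]. -/
lemma IsBuchsbaumAlgebra.inequalities (ha : 1 ≤ a) (hab : a + 2 ≤ b) (hbd : b < d)
    (hB : IsBuchsbaumAlgebra (twoIntervalAlgebra k a b d)) :
    b ≤ 2 * a + 1 ∧ 2 * b ≤ a + d + 1 := by
  have had : a < d := by omega
  constructor <;> by_contra hlt
  · obtain ⟨i, j, hij, h⟩ := IsBuchsbaumLocalRing.exists_of_le (k := k) ha hbd had hB (s := 0) (p := 2 * a + 1) (by omega)
      (by omega)
    obtain ⟨rfl, rfl⟩ | ⟨rfl, rfl⟩ | ⟨rfl, rfl⟩ :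
      i = 0 ∧ j = 2 ∨ i = 1 ∧ j = 1 ∨ i = 2 ∧ j = 0 := by omega
    all_goals omega
  · obtain ⟨i, j, hij, h⟩ := IsBuchsbaumLocalRing.exists_of_le (k := k) ha hbd had hB (s := d) (p := a + 1) (by omega)
      (by omega)
    obtain ⟨rfl, rfl⟩ | ⟨rfl, rfl⟩ | ⟨rfl, rfl⟩ :
      i = 0 ∧ j = 2 ∨ i = 1 ∧ j = 1 ∨ i = 2 ∧ j = 0 := by omega
    all_goals omega

end LocalRing

theorem mainTheorem6 (k : Type*) [Field k] (a b d : ℕ)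
    (ha : 1 ≤ a) (hab : a + 2 ≤ b) (hbd : b < d) :
    List.TFAE [
      IsBuchsbaumAlgebra (twoIntervalAlgebra k a b d),
      b ≤ 2 * a + 1 ∧ 2 * b ≤ a + d + 1,
      IsReduction (parameterIdeal (twoIntervalAlgebra k a b d) d)
          (irrelevantIdeal (twoIntervalAlgebra k a b d)) ∧
        reductionNumber (parameterIdeal (twoIntervalAlgebra k a b d) d)
          (irrelevantIdeal (twoIntervalAlgebra k a b d)) = 2] := by
  tfae_have 1 → 2 := fun hB => hB.inequalities ha hab hbd
  tfae_have 2 → 1 := fun h => isBuchsbaumLocalRing_of_inequalities (k := k) hbd (by omega) h _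
  tfae_have 3 ↔ 2 := reductionNumber_eq_two_iff ha hab hbd
  tfae_finish
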